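/- Let $C([0,\pi])$ denote the space of real-valued continuous functions on $[0,\pi]$ with the supremum norm. Let $M>0$ be such that the set $$V_M:=\Big\{v\in C([0,\pi]):\ 0\le v\le M,\ \int_0^\pi v(x)\sin(x)\,dx=1\Big\}$$ is non-empty. Let $\alpha>0$ with $\alpha\neq 1$, let $S:C([0,\pi])\to C([0,\pi])$ be a linear and compact operator, and for non-negative $v\in C([0,\pi])$ put $$Av:=S\big(v^{1/\alpha}\big).$$ Assume that: 1. there exists $\rho>0$ such that, for every $v\in V_M$, $$\int_0^\pi Av(x)\sin(x)\,dx=\rho\int_0^\pi v(x)^{1/\alpha}\sin(x)\,dx;$$ 2. for every $v\in V_M$ and every $x\in[0,\pi]$, $$0\le Av(x)\le M\int_0^\pi Av(y)\sin(y)\,dy.$$ Then $A$ has a non-zero fixed point in $C([0,\pi])$ that is a multiple of an element of $V_M$: there exist $v\in V_M$ and $\Gamma>0$ such that $w:=\Gamma v$ satisfies $w\neq 0$ and $Aw=w$. -/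

import Mathlib

noncomputable section

/-- The space `C([0,π])` of real-valued continuous functions on `[0,π]`; Mathlib equips it with
the supremum norm. -/
abbrev CZeroPi : Type := C(Set.Icc (0 : ℝ) Real.pi, ℝ)

/-- The integral `∫₀^π v(x) sin(x) dx` with respect to Lebesgue measure on `[0,π]`. -/
def sinIntegral (v : CZeroPi) : ℝ :=
  ∫ x : Set.Icc (0 : ℝ) Real.pi, v x * Real.sin (x : ℝ)
    ∂(MeasureTheory.Measure.comap Subtype.val MeasureTheory.volume)

/-- The set `V_M` of all `v ∈ C([0,π])` with `0 ≤ v ≤ M` and `∫₀^π v(x) sin(x) dx = 1`. -/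
def VSet (M : ℝ) : Set CZeroPi :=
  {v | (∀ x, 0 ≤ v x ∧ v x ≤ M) ∧ sinIntegral v = 1}

/-- The pointwise power `v ^ p`, with `p ≥ 0`. It is the usual power for `v ≥ 0`, the only
functions to which it is applied in the theorem. -/
def powFun (p : ℝ) (hp : 0 ≤ p) (v : CZeroPi) : CZeroPi :=
  ⟨fun x => v x ^ p, v.continuous.rpow_const fun _ => Or.inr hp⟩

/-- The nonlinear operator `A v = S (v ^ (1 / α))`. -/
def opA (α : ℝ) (hα : 0 < α) (S : CZeroPi →ₗ[ℝ] CZeroPi) (v : CZeroPi) : CZeroPi :=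
  S (powFun (1 / α) (one_div_pos.mpr hα).le v)

end

/-!
On the closed convex set `VSet M` consider the normalized map `T v = (∫ A v sin)⁻¹ • A v`. The
hypotheses on `A` say exactly that `T` maps `VSet M` to itself, provided that the normalizing
integral is positive. It is even bounded below by a positive constant, because `∫ v sin = 1` and
`v ≤ M` bound `∫ v ^ (1 / α) sin` from below (`exists_pos_le_sinIntegral_powFun`). Since `S` is
compact, `T` is continuous with relatively compact range, so Schauder's theorem
(`exists_fixedPoint_of_mapsTo_convex`) gives `v` with `A v = c • v`, `c > 0`. As `A` is homogeneous
of degree `1 / α ≠ 1`, the factor `c` is absorbed by rescaling `v`.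

Schauder's theorem is reduced to Brouwer's theorem on the standard simplex
(`exists_fixedPoint_of_mapsTo_stdSimplex`) by finite nets. Brouwer's theorem is obtained without
triangulations from Scarf's lemma (`scarf_lemma`), a parity statement about finite sets with several
linear orders, applied to finite nets of the simplex ordered by their coordinates.
-/

/-! ### Scarf's lemma -/

/-- A finite set `X` is dominant for the family of rankings `r i` if no point lies strictly above
the minimum of `X` in every ranking simultaneously. -/
def Dominant {I P β : Type*} [LE β] (r : I → P → β) (X : Finset P) : Prop :=
  ∀ y, ∃ i, ∀ x ∈ X, r i y ≤ r i x

theorem Dominant.mono {I P β : Type*} [LE β] {r : I → P → β} {X Y : Finset P}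
    (hY : Dominant r Y) (hXY : X ⊆ Y) : Dominant r X := fun y =>
  (hY y).imp fun _ hi x hx => hi x (hXY hx)

open scoped Classical in
/-- A nonempty dominant set with one element fewer than there are rankings has exactly two dominant
one-point extensions. Two rankings `a` and `b` share their minimum on `X`; discarding one of them
leaves a set of points violating dominance, and the new point is the highest of these in the
discarded ranking. The hypothesis `hup` says that such violating points exist. -/
theorem Dominant.card_filter_insert_eq_two {I P β : Type*} [Fintype I] [Fintype P] [LinearOrder β]
    {r : I → P → β} (hr : ∀ i, Function.Injective (r i)) {X : Finset P} (hX : X.Nonempty)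
    (hdom : Dominant r X) (hcard : X.card + 1 = Fintype.card I)
    (hup : ∀ i, ∃ y, ∀ j, j ≠ i → ∃ x ∈ X, r j x < r j y) :
    (Finset.univ.filter fun p => p ∉ X ∧ Dominant r (insert p X)).card = 2 := by
  have hmin : ∀ i, ∃ x ∈ X, ∀ z ∈ X, r i x ≤ r i z := fun i => X.exists_min_image (r i) hX
  choose m hmX hm using hmin
  -- Every element of a dominant set is its minimum in some ranking.
  have hsurj : ∀ x ∈ X, ∃ i, m i = x := fun x hx => by
    obtain ⟨i, hi⟩ := hdom x
    exact ⟨i, hr i (le_antisymm (hm i x hx) (hi _ (hmX i)))⟩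
  obtain ⟨a, -, b, -, hab, hmab⟩ := Finset.exists_ne_map_eq_of_card_lt_of_maps_to
    (s := (Finset.univ : Finset I)) (t := X) (f := m)
    (by rw [Finset.card_univ]; omega) (fun i _ => hmX i)
  -- `Y i` consists of the points that violate dominance once the ranking `i` is discarded.
  set Y : I → Finset P := fun i => Finset.univ.filter fun y => ∀ j, j ≠ i → r j (m j) < r j y
    with hYdef
  have memY : ∀ {i y}, y ∈ Y i ↔ ∀ j, j ≠ i → r j (m j) < r j y := by simp [hYdef]
  have hYne : ∀ i, (Y i).Nonempty := fun i => by
    obtain ⟨y, hy⟩ := hup i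
    refine ⟨y, memY.2 fun j hj => ?_⟩
    obtain ⟨x, hx, hlt⟩ := hy j hj
    exact (hm j x hx).trans_lt hlt
  choose q hqY hq using fun i => (Y i).exists_max_image (r i) (hYne i)
  have hsurj' : ∀ i, i = a ∨ i = b → ∀ x ∈ X, ∃ j, j ≠ i ∧ m j = x := by
    intro i hi x hx
    obtain ⟨j, hj⟩ := hsurj x hx
    by_cases hji : j = i
    · subst hji
      rcases hi with rfl | rfl
      · exact ⟨b, hab.symm, by rw [← hmab, hj]⟩
      · exact ⟨a, hab, by rw [hmab, hj]⟩
    · exact ⟨j, hji, hj⟩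
  have hqmem : ∀ i, i = a ∨ i = b → q i ∉ X ∧ Dominant r (insert (q i) X) := by
    intro i hi
    refine ⟨fun hqX => ?_, fun z => ?_⟩
    · obtain ⟨j, hji, hj⟩ := hsurj' i hi _ hqX
      have := memY.1 (hqY i) j hji
      rw [hj] at this
      exact lt_irrefl _ this
    · by_cases hz : z ∈ Y i
      · obtain ⟨k, hk⟩ := hdom z
        have hki : k = i := by
          by_contra hne
          exact absurd (hk _ (hmX k)) (not_le.2 (memY.1 hz k hne))
        subst hki
        refine ⟨k, fun x hx => ?_⟩
        rcases Finset.mem_insert.1 hx with rfl | hx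
        · exact hq k z hz
        · exact hk x hx
      · rw [memY] at hz
        push Not at hz
        obtain ⟨j, hji, hj⟩ := hz
        refine ⟨j, fun x hx => ?_⟩
        rcases Finset.mem_insert.1 hx with rfl | hx
        · exact hj.trans (memY.1 (hqY i) j hji).le
        · exact hj.trans (hm j x hx)
  have hqne : q a ≠ q b := by
    intro h
    obtain ⟨k, hk⟩ := hdom (q a)
    have hk' := hk _ (hmX k)
    by_cases hka : k = a
    · have := memY.1 (hqY b) k (by rw [hka]; exact hab)
      rw [← h] at this
      exact absurd hk' (not_le.2 this)
    · exact absurd hk' (not_le.2 (memY.1 (hqY a) k hka))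
  have hset : (Finset.univ.filter fun p => p ∉ X ∧ Dominant r (insert p X)) = {q a, q b} := by
    ext p
    simp only [Finset.mem_filter, Finset.mem_univ, true_and, Finset.mem_insert,
      Finset.mem_singleton]
    constructor
    · rintro ⟨hpX, hp⟩
      obtain ⟨i, hi⟩ := hp p
      have hpi : r i p < r i (m i) :=
        lt_of_le_of_ne (hi _ (Finset.mem_insert_of_mem (hmX i)))
          fun h => hpX (hr i h ▸ hmX i)
      have hcover : ∀ x ∈ X, ∃ j, j ≠ i ∧ m j = x ∧ r j x < r j p := by
        intro x hx
        obtain ⟨j, hj⟩ := hp x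
        have hjp := hj p (Finset.mem_insert_self _ _)
        have hjx : m j = x :=
          hr j (le_antisymm (hm j x hx) (hj _ (Finset.mem_insert_of_mem (hmX j))))
        refine ⟨j, ?_, hjx, lt_of_le_of_ne hjp fun h => hpX (hr j h ▸ hx)⟩
        rintro rfl
        rw [← hjx] at hjp
        exact absurd hjp (not_le.2 hpi)
      -- The rankings other than `i` are as many as the points of `X`, so `m` is injective there.
      have hinj : Set.InjOn m (Finset.univ.erase i : Finset I) := by
        apply Finset.injOn_of_surjOn_of_card_le (t := X) m
        · exact fun j _ => hmX j
        · intro x hx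
          obtain ⟨j, hji, hj, -⟩ := hcover x hx
          exact ⟨j, by simpa using hji, hj⟩
        · rw [Finset.card_erase_of_mem (Finset.mem_univ _), Finset.card_univ]; omega
      have hiab : i = a ∨ i = b := by
        by_contra hne
        push Not at hne
        exact hab (hinj (by simpa using hne.1.symm) (by simpa using hne.2.symm) hmab)
      have hpY : p ∈ Y i := memY.2 fun j hji => by
        obtain ⟨k, hki, hk, hlt⟩ := hcover (m j) (hmX j)
        have : k = j := hinj (by simpa using hki) (by simpa using hji) hk
        subst this
        exact hlt
      have hpmax : r i (q i) ≤ r i p := by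
        obtain ⟨k, hk⟩ := hp (q i)
        by_cases hki : k = i
        · subst hki
          exact hk p (Finset.mem_insert_self _ _)
        · exact absurd (hk _ (Finset.mem_insert_of_mem (hmX k)))
            (not_le.2 (memY.1 (hqY i) k hki))
      have : p = q i := hr i (le_antisymm (hq i p hpY) hpmax)
      rcases hiab with rfl | rfl
      · exact Or.inl this
      · exact Or.inr this
    · rintro (rfl | rfl)
      · exact hqmem a (Or.inl rfl)
      · exact hqmem b (Or.inr rfl)
  rw [hset, Finset.card_pair hqne]

open scoped Classical in
/-- If a set `Y` with as many elements as there are colours misses a colour, then the number of its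
points whose removal leaves exactly the colours other than `i₀` is `0` or `2`: two such points have
the same colour. -/
theorem card_filter_image_erase_even {I P : Type*} [Fintype I] (c : P → I)
    {Y : Finset P} (hY : Y.card = Fintype.card I) (hc : Y.image c ≠ Finset.univ) (i₀ : I) :
    Even (Y.filter fun x => (Y.erase x).image c = Finset.univ.erase i₀).card := by
  by_cases hne : (Y.filter fun x => (Y.erase x).image c = Finset.univ.erase i₀).Nonempty
  swap
  · rw [Finset.not_nonempty_iff_eq_empty.1 hne]; simp
  obtain ⟨x, hx⟩ := hne
  obtain ⟨hxY, hx⟩ := Finset.mem_filter.1 hx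
  have hcardx : (Y.erase x).card = (Finset.univ.erase i₀).card := by
    rw [Finset.card_erase_of_mem hxY, Finset.card_erase_of_mem (Finset.mem_univ _),
      Finset.card_univ, hY]
  have hinj : Set.InjOn c (Y.erase x : Finset P) :=
    Finset.card_image_iff.1 (by rw [hx, hcardx])
  have hcx : c x ≠ i₀ := by
    intro h
    apply hc
    rw [← Finset.insert_erase hxY, Finset.image_insert, hx, h,
      Finset.insert_erase (Finset.mem_univ _)]
  obtain ⟨x', hx', hcx'⟩ : ∃ x' ∈ Y.erase x, c x' = c x := by
    rw [← Finset.mem_image, hx]; simpa using hcx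
  have hxx' := Finset.ne_of_mem_erase hx'
  have hx'Y := Finset.mem_of_mem_erase hx'
  have hset : (Y.filter fun x => (Y.erase x).image c = Finset.univ.erase i₀) = {x, x'} := by
    ext z
    simp only [Finset.mem_filter, Finset.mem_insert, Finset.mem_singleton]
    constructor
    · rintro ⟨hzY, hz⟩
      by_contra hne
      push Not at hne
      have hcardz : (Y.erase z).card = (Finset.univ.erase i₀).card := by
        rw [Finset.card_erase_of_mem hzY, Finset.card_erase_of_mem (Finset.mem_univ _),
          Finset.card_univ, hY]
      have hinjz : Set.InjOn c (Y.erase z : Finset P) :=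
        Finset.card_image_iff.1 (by rw [hz, hcardz])
      exact hxx' (hinjz (by simp [hx'Y, hne.2.symm]) (by simp [hxY, hne.1.symm]) hcx')
    · rintro (rfl | rfl)
      · exact ⟨hxY, hx⟩
      · refine ⟨hx'Y, ?_⟩
        have hsplit : Y.erase z = insert x ((Y.erase x).erase z) := by
          ext w
          simp only [Finset.mem_erase, Finset.mem_insert]
          constructor
          · rintro ⟨h1, h2⟩
            by_cases hwx : w = x
            · exact Or.inl hwx
            · exact Or.inr ⟨h1, hwx, h2⟩
          · rintro (rfl | ⟨h1, -, h2⟩)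
            · exact ⟨hxx'.symm, hxY⟩
            · exact ⟨h1, h2⟩
        rw [hsplit, Finset.image_insert, ← hcx', ← Finset.image_insert,
          Finset.insert_erase hx', hx]
  rw [hset, Finset.card_pair hxx'.symm]
  exact even_two

open scoped Classical in
/-- Scarf's lemma for strict rankings with slack points: `s i` is lowest in the ranking `i` and, in
every other ranking, above all points outside the range of `s`. Assuming there is no dominant set of
all colours, count incidences between *rooms* (dominant sets of `card I` points) and their *doors*
(one point fewer, with the colours other than `i₀`). Every room has an even number of doors, while
every door lies in two rooms, except the door formed by the slack points, which lies in one. -/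
theorem exists_dominant_image_eq_univ {I P β : Type*} [Fintype I] [Nonempty I] [Fintype P]
    [LinearOrder β] {r : I → P → β} (hr : ∀ i, Function.Injective (r i)) (s : I → P)
    (hbot : ∀ i p, r i (s i) ≤ r i p)
    (htop : ∀ i j p, j ≠ i → p ∉ Set.range s → r i p < r i (s j))
    (hP : ∃ p, p ∉ Set.range s) (c : P → I) (hc : ∀ i, c (s i) = i) :
    ∃ X : Finset P, Dominant r X ∧ X.image c = Finset.univ := by
  by_contra hcon
  push Not at hcon
  obtain ⟨i₀⟩ := ‹Nonempty I›
  set doors : Finset (Finset P) := Finset.univ.filter fun X =>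
    Dominant r X ∧ X.card + 1 = Fintype.card I ∧ X.image c = Finset.univ.erase i₀ with hdoors
  set rooms : Finset (Finset P) := Finset.univ.filter fun Y =>
    Dominant r Y ∧ Y.card = Fintype.card I with hrooms
  have hpos : 0 < Fintype.card I := Fintype.card_pos_iff.2 ⟨i₀⟩
  -- Both sides count the pairs consisting of a room and one of its doors.
  have hcount : ∑ X ∈ doors, (Finset.univ.filter fun p => p ∉ X ∧ Dominant r (insert p X)).card =
      ∑ Y ∈ rooms, (Y.filter fun x => (Y.erase x).image c = Finset.univ.erase i₀).card := by
    rw [← Finset.card_sigma, ← Finset.card_sigma]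
    refine Finset.card_bij' (fun a _ => ⟨insert a.2 a.1, a.2⟩) (fun a _ => ⟨a.1.erase a.2, a.2⟩)
      ?_ ?_ ?_ ?_
    · rintro ⟨X, p⟩ h
      simp only [Finset.mem_sigma, hdoors, hrooms, Finset.mem_filter, Finset.mem_univ,
        true_and] at h ⊢
      obtain ⟨⟨-, h2, h3⟩, h4, h5⟩ := h
      refine ⟨⟨h5, by rw [Finset.card_insert_of_notMem h4, h2]⟩, Finset.mem_insert_self _ _, ?_⟩
      rw [Finset.erase_insert h4, h3]
    · rintro ⟨Y, x⟩ h
      simp only [Finset.mem_sigma, hdoors, hrooms, Finset.mem_filter, Finset.mem_univ,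
        true_and] at h ⊢
      obtain ⟨⟨h1, h2⟩, h3, h4⟩ := h
      refine ⟨⟨h1.mono (Finset.erase_subset _ _), ?_, h4⟩, Finset.notMem_erase _ _, ?_⟩
      · rw [Finset.card_erase_of_mem h3]; omega
      · rwa [Finset.insert_erase h3]
    · rintro ⟨X, p⟩ h
      simp only [Finset.mem_sigma, Finset.mem_filter] at h
      simp [Finset.erase_insert h.2.2.1]
    · rintro ⟨Y, x⟩ h
      simp only [Finset.mem_sigma, Finset.mem_filter] at h
      simp [Finset.insert_erase h.2.1]
  have hright : Even (∑ Y ∈ rooms,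
      (Y.filter fun x => (Y.erase x).image c = Finset.univ.erase i₀).card) := by
    refine Finset.even_sum _ fun Y hY => ?_
    obtain ⟨-, hY1, hY2⟩ := Finset.mem_filter.1 hY
    exact card_filter_image_erase_even c hY2 (hcon Y hY1) i₀
  have hsinj : Function.Injective s := fun i j h => by rw [← hc i, h, hc j]
  set X₀ : Finset P := (Finset.univ.erase i₀).image s with hX₀
  obtain ⟨t₀, ht₀, htmax⟩ := (Finset.univ.filter fun p => p ∉ Set.range s).exists_max_image (r i₀)
    (by obtain ⟨p, hp⟩ := hP; exact ⟨p, by simpa using hp⟩)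
  have ht₀ : t₀ ∉ Set.range s := (Finset.mem_filter.1 ht₀).2
  have htmax : ∀ p, p ∉ Set.range s → r i₀ p ≤ r i₀ t₀ := fun p hp =>
    htmax p (Finset.mem_filter.2 ⟨Finset.mem_univ _, hp⟩)
  have hmemX₀ : ∀ {p}, p ∈ X₀ ↔ ∃ j, j ≠ i₀ ∧ s j = p := by simp [hX₀]
  have hdom₀ : Dominant r (insert t₀ X₀) := by
    intro y
    by_cases hy : y ∈ Set.range s
    · obtain ⟨j, rfl⟩ := hy
      exact ⟨j, fun x _ => hbot j x⟩
    · refine ⟨i₀, fun x hx => ?_⟩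
      rcases Finset.mem_insert.1 hx with rfl | hx
      · exact htmax y hy
      · obtain ⟨j, hj, rfl⟩ := hmemX₀.1 hx
        exact (htop i₀ j y hj hy).le
  have hX₀door : X₀ ∈ doors := by
    refine Finset.mem_filter.2 ⟨Finset.mem_univ _, hdom₀.mono (Finset.subset_insert _ _), ?_, ?_⟩
    · rw [hX₀, Finset.card_image_of_injective _ hsinj,
        Finset.card_erase_of_mem (Finset.mem_univ _), Finset.card_univ]
      omega
    · rw [hX₀, Finset.image_image, show c ∘ s = id from funext hc, Finset.image_id]
  have hone : (Finset.univ.filter fun p => p ∉ X₀ ∧ Dominant r (insert p X₀)).card = 1 := by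
    rw [Finset.card_eq_one]
    refine ⟨t₀, ?_⟩
    ext p
    simp only [Finset.mem_filter, Finset.mem_univ, true_and, Finset.mem_singleton]
    constructor
    · rintro ⟨hpX, hp⟩
      obtain ⟨i, hi⟩ := hp t₀
      have hii : i = i₀ := by
        by_contra hne
        have := hi (s i) (Finset.mem_insert_of_mem (hmemX₀.2 ⟨i, hne, rfl⟩))
        exact ht₀ ⟨i, hr i (le_antisymm (hbot i _) this)⟩
      subst hii
      have hle := hi p (Finset.mem_insert_self _ _)
      by_cases hps : p ∈ Set.range s
      · obtain ⟨j, rfl⟩ := hps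
        by_cases hj : j = i
        · subst hj
          exact absurd ⟨j, hr j (le_antisymm (hbot j _) hle)⟩ ht₀
        · exact absurd (hmemX₀.2 ⟨j, hj, rfl⟩) hpX
      · exact hr i (le_antisymm (htmax p hps) hle)
    · rintro rfl
      refine ⟨fun h => ?_, hdom₀⟩
      obtain ⟨j, -, hj⟩ := hmemX₀.1 h
      exact ht₀ ⟨j, hj⟩
  have htwo : ∀ X ∈ doors.erase X₀,
      (Finset.univ.filter fun p => p ∉ X ∧ Dominant r (insert p X)).card = 2 := by
    intro X hX
    obtain ⟨hne, hX⟩ := Finset.mem_erase.1 hX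
    obtain ⟨-, hXdom, hXcard, hXc⟩ := Finset.mem_filter.1 hX
    -- A door other than `X₀` contains a point outside the range of `s`.
    obtain ⟨t, htX, hts⟩ : ∃ t ∈ X, t ∉ Set.range s := by
      by_contra hall
      push Not at hall
      apply hne
      apply Finset.eq_of_subset_of_card_le
      · intro x hx
        obtain ⟨j, rfl⟩ := hall x hx
        have : c (s j) ∈ X.image c := Finset.mem_image_of_mem c hx
        rw [hXc, hc] at this
        exact hmemX₀.2 ⟨j, Finset.ne_of_mem_erase this, rfl⟩
      · rw [hX₀, Finset.card_image_of_injective _ hsinj,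
          Finset.card_erase_of_mem (Finset.mem_univ _), Finset.card_univ]
        omega
    exact hXdom.card_filter_insert_eq_two hr ⟨t, htX⟩ hXcard fun i =>
      ⟨s i, fun j hj => ⟨t, htX, htop j i t hj.symm hts⟩⟩
  rw [← hcount, ← Finset.add_sum_erase _ _ hX₀door, hone, Finset.sum_congr rfl htwo,
    Finset.sum_const, smul_eq_mul, add_comm] at hright
  exact Nat.not_even_iff_odd.2 ((even_two.mul_left _).add_one) hright

open scoped Classical in
/-- **Scarf's lemma**: for real functions `u i` on a finite set coloured by the indices `i`, some
subset `σ` has the property that no point exceeds `min_σ (u i)` for all colours `i` occurring in `σ`.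
Ties are broken lexicographically by an enumeration, and one slack point per index is added. -/
theorem scarf_lemma {I T : Type*} [Fintype I] [Nonempty I] [Fintype T] [Nonempty T]
    (u : I → T → ℝ) (c : T → I) :
    ∃ σ : Finset T, ∀ y, ∃ i ∈ σ.image c, ∀ x ∈ σ, u i y ≤ u i x := by
  let key : I → T ⊕ I → ℝ := fun i => Sum.elim (u i) fun j =>
    if j = i then (⨅ t, u i t) - 1 else (⨆ t, u i t) + 1
  let e := Fintype.equivFin (T ⊕ I)
  let r : I → T ⊕ I → ℝ ×ₗ Fin (Fintype.card (T ⊕ I)) := fun i p => toLex (key i p, e p)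
  have hr : ∀ i, Function.Injective (r i) := fun i p q h => by
    have := congrArg (fun z => (ofLex z).2) h
    exact e.injective this
  have hlt : ∀ {i p q}, key i p < key i q → r i p < r i q := fun h =>
    Prod.Lex.toLex_lt_toLex.2 (Or.inl h)
  have hinf : ∀ i t, (⨅ t, u i t) - 1 < u i t := fun i t => by
    have := ciInf_le (Set.finite_range (u i)).bddBelow t
    linarith
  have hsup : ∀ i t, u i t < (⨆ t, u i t) + 1 := fun i t => by
    have := le_ciSup (Set.finite_range (u i)).bddAbove t
    linarith
  have hbot : ∀ i p, p ≠ Sum.inr i → r i (Sum.inr i) < r i p := by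
    rintro i (t | j) hp
    · exact hlt (by simpa [key] using hinf i t)
    · have hj : j ≠ i := fun h => hp (by rw [h])
      refine hlt ?_
      obtain ⟨t⟩ := ‹Nonempty T›
      simpa [key, hj] using (hinf i t).trans (hsup i t)
  obtain ⟨X, hX, hXc⟩ := exists_dominant_image_eq_univ hr (Sum.inr : I → T ⊕ I)
    (fun i p => by
      by_cases hp : p = Sum.inr i
      · rw [hp]
      · exact (hbot i p hp).le)
    (fun i j p hj hp => by
      rcases p with t | k
      · exact hlt (by simpa [key, hj] using hsup i t)
      · exact absurd ⟨k, rfl⟩ hp)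
    (by obtain ⟨t⟩ := ‹Nonempty T›; exact ⟨Sum.inl t, by simp⟩)
    (Sum.elim c id) (fun i => rfl)
  refine ⟨Finset.univ.filter fun t => Sum.inl t ∈ X, fun y => ?_⟩
  obtain ⟨i, hi⟩ := hX (Sum.inl y)
  refine ⟨i, ?_, fun x hx => ?_⟩
  · obtain ⟨p, hp, hpi⟩ := Finset.mem_image.1 (hXc ▸ Finset.mem_univ i)
    rcases p with t | j
    · exact Finset.mem_image.2 ⟨t, by simpa using hp, hpi⟩
    · obtain rfl : j = i := hpi
      exact absurd (hi _ hp) (not_le.2 (hbot j _ (by simp)))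
  · have h := hi (Sum.inl x) (by simpa using hx)
    rcases Prod.Lex.toLex_le_toLex.1 h with h | h
    · exact h.le
    · exact h.1.le

/-! ### Brouwer's fixed point theorem -/

/-- Two points of the simplex with a common lower bound of almost full mass are close. -/
theorem dist_le_of_mem_stdSimplex_of_le {I : Type*} [Fintype I] [Nonempty I] {z w l : I → ℝ}
    {κ : ℝ} (hz : z ∈ stdSimplex ℝ I) (hw : w ∈ stdSimplex ℝ I) (hlz : ∀ i, l i ≤ z i)
    (hlw : ∀ i, l i ≤ w i) (hl : 1 - κ ≤ ∑ i, l i) : dist z w ≤ κ := by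
  have key : ∀ {v : I → ℝ}, v ∈ stdSimplex ℝ I → (∀ i, l i ≤ v i) → ∀ i, v i ≤ l i + κ := by
    intro v hv hlv i
    have h1 : v i - l i ≤ ∑ j, (v j - l j) :=
      Finset.single_le_sum (f := fun j => v j - l j) (fun j _ => sub_nonneg.2 (hlv j))
        (Finset.mem_univ i)
    rw [Finset.sum_sub_distrib, hv.2] at h1
    linarith
  refine (dist_pi_le_iff' ).2 fun i => ?_
  rw [Real.dist_eq, abs_le]
  have h1 := key hz hlz i
  have h2 := key hw hlw i
  constructor <;> linarith [hlz i, hlw i]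

/-- Approximate form of Brouwer's theorem. On a fine net, colour a point `x` by an index `i` with
`x i ≤ f x i`. A set `σ` as in Scarf's lemma is small, because the minima of its coordinates almost
sum to `1`; these minima then bound both `x` and `f x` from below up to a small error. -/
theorem exists_dist_le_of_mapsTo_stdSimplex {I : Type*} [Fintype I] [Nonempty I]
    {f : (I → ℝ) → I → ℝ} (hf : ContinuousOn f (stdSimplex ℝ I))
    (hmaps : Set.MapsTo f (stdSimplex ℝ I) (stdSimplex ℝ I)) {κ : ℝ} (hκ : 0 < κ) :
    ∃ x ∈ stdSimplex ℝ I, dist (f x) x ≤ κ := by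
  classical
  set n : ℝ := ((Fintype.card I : ℕ) : ℝ) with hn
  have hn0 : 0 < n := by rw [hn]; exact_mod_cast Fintype.card_pos
  have hcompact := isCompact_stdSimplex ℝ I
  set ε : ℝ := κ / (2 * n) with hε
  have hε0 : 0 < ε := by positivity
  have hnε : n * ε = κ / 2 := by rw [hε]; field_simp
  obtain ⟨δ, hδ, hfδ⟩ := Metric.uniformContinuousOn_iff.1
    (hcompact.uniformContinuousOn_of_continuous hf) ε hε0
  set η : ℝ := min δ κ / (2 * n) with hη
  have hη0 : 0 < η := by have := lt_min hδ hκ; positivity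
  have hnη : n * η = min δ κ / 2 := by rw [hη]; field_simp
  obtain ⟨t, hts, htfin, hcover⟩ := Metric.finite_approx_of_totallyBounded
    hcompact.totallyBounded η hη0
  have : Fintype t := htfin.fintype
  obtain ⟨i₁⟩ := ‹Nonempty I›
  have : Nonempty t := by
    obtain ⟨y, hy, -⟩ := Set.mem_iUnion₂.1 (hcover (single_mem_stdSimplex ℝ i₁))
    exact ⟨⟨y, hy⟩⟩
  have hcol : ∀ x : t, ∃ i, x.1 i ≤ f x.1 i := by
    intro x
    by_contra! hlt
    have := Finset.sum_lt_sum_of_nonempty (s := Finset.univ) ⟨i₁, Finset.mem_univ _⟩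
      fun i _ => hlt i
    rw [(hts x.2).2, (hmaps (hts x.2)).2] at this
    exact lt_irrefl _ this
  choose c hc using hcol
  obtain ⟨σ, hσ⟩ := scarf_lemma (fun i (x : t) => x.1 i) c
  have hσne : σ.Nonempty := by
    obtain ⟨i, hi, -⟩ := hσ (Classical.arbitrary t)
    exact Finset.image_nonempty.1 ⟨i, hi⟩
  choose m hmσ hm using fun i => σ.exists_min_image (fun x => x.1 i) hσne
  -- The coordinatewise lower bound of `σ` on the colours that occur has almost full mass.
  set l : I → ℝ := fun i => if i ∈ σ.image c then (m i).1 i else 0 with hl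
  have hlx : ∀ x ∈ σ, ∀ i, l i ≤ x.1 i := by
    intro x hx i
    simp only [hl]
    split_ifs
    · exact hm i x hx
    · exact (hts x.2).1 i
  have hl0 : ∀ i, 0 ≤ l i := by
    intro i
    simp only [hl]
    split_ifs
    · exact (hts (m i).2).1 i
    · exact le_rfl
  have hsum : 1 - n * η ≤ ∑ i, l i := by
    by_contra! hlt
    set d : ℝ := (1 - ∑ i, l i) / n with hd
    have hdη : η < d := by rw [hd, lt_div_iff₀ hn0]; linarith
    have hmem : (fun i => l i + d) ∈ stdSimplex ℝ I := by
      refine ⟨fun i => add_nonneg (hl0 i) (hη0.trans hdη).le, ?_⟩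
      rw [Finset.sum_add_distrib, Finset.sum_const, Finset.card_univ, nsmul_eq_mul, ← hn, hd]
      field_simp
      ring
    obtain ⟨y, hy, hball⟩ := Set.mem_iUnion₂.1 (hcover hmem)
    obtain ⟨i, hi, hle⟩ := hσ ⟨y, hy⟩
    have h1 : y i ≤ (m i).1 i := hle (m i) (hmσ i)
    have h2 := (dist_le_pi_dist (fun i => l i + d) y i).trans_lt (Metric.mem_ball.1 hball)
    rw [Real.dist_eq, abs_lt] at h2
    have h3 : l i = (m i).1 i := by simp only [hl]; rw [if_pos hi]
    linarith [h2.2]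
  have hdiam : ∀ x ∈ σ, ∀ x' ∈ σ, dist x.1 x'.1 < δ := by
    intro x hx x' hx'
    refine (dist_le_of_mem_stdSimplex_of_le (hts x.2) (hts x'.2) (hlx x hx) (hlx x' hx')
      hsum).trans_lt ?_
    rw [hnη]
    linarith [min_le_left δ κ]
  obtain ⟨x₀, hx₀⟩ := hσne
  refine ⟨x₀.1, hts x₀.2, dist_le_of_mem_stdSimplex_of_le (l := fun i => l i - ε)
    (hmaps (hts x₀.2)) (hts x₀.2) (fun i => ?_) (fun i => ?_) ?_⟩
  · by_cases hi : i ∈ σ.image c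
    · obtain ⟨x, hx, rfl⟩ := Finset.mem_image.1 hi
      have h1 := (dist_le_pi_dist (f x.1) (f x₀.1) (c x)).trans_lt
        (hfδ _ (hts x.2) _ (hts x₀.2) (hdiam x hx x₀ hx₀))
      rw [Real.dist_eq, abs_lt] at h1
      linarith [hc x, hlx x hx (c x), h1.2]
    · have : l i = 0 := by simp only [hl]; rw [if_neg hi]
      linarith [(hmaps (hts x₀.2)).1 i]
  · linarith [hlx x₀ hx₀ i]
  · rw [Finset.sum_sub_distrib, Finset.sum_const, Finset.card_univ, nsmul_eq_mul, ← hn, hnε]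
    rw [hnη] at hsum
    linarith [min_le_right δ κ]

/-- **Brouwer's fixed point theorem** for the standard simplex. -/
theorem exists_fixedPoint_of_mapsTo_stdSimplex {I : Type*} [Fintype I] [Nonempty I]
    {f : (I → ℝ) → I → ℝ} (hf : ContinuousOn f (stdSimplex ℝ I))
    (hmaps : Set.MapsTo f (stdSimplex ℝ I) (stdSimplex ℝ I)) :
    ∃ x ∈ stdSimplex ℝ I, f x = x := by
  obtain ⟨y, hy, -⟩ := exists_dist_le_of_mapsTo_stdSimplex hf hmaps one_pos
  obtain ⟨x, hx, hmin⟩ := (isCompact_stdSimplex ℝ I).exists_isMinOn ⟨y, hy⟩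
    (continuous_dist.comp_continuousOn (hf.prodMk continuousOn_id))
  refine ⟨x, hx, dist_le_zero.1 (le_of_forall_pos_le_add fun κ hκ => ?_)⟩
  obtain ⟨z, hz, hzκ⟩ := exists_dist_le_of_mapsTo_stdSimplex hf hmaps hκ
  rw [zero_add]
  exact (hmin hz).trans hzκ

/-! ### Schauder's fixed point theorem -/

/-- Approximate form of Schauder's theorem: project `K` to the convex hull of a finite `ε`-net and
apply Brouwer's theorem to the barycentric coordinates. -/
theorem exists_dist_le_of_mapsTo_convex {E : Type*} [NormedAddCommGroup E] [NormedSpace ℝ E]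
    {C K : Set E} (hC : Convex ℝ C) (hne : C.Nonempty) (hK : IsCompact K) (hKC : K ⊆ C)
    {T : E → E} (hT : ContinuousOn T C) (hmaps : Set.MapsTo T C K) {ε : ℝ} (hε : 0 < ε) :
    ∃ x ∈ C, dist x (T x) ≤ ε := by
  classical
  obtain ⟨t, htK, htfin, hcover⟩ := Metric.finite_approx_of_totallyBounded
    hK.totallyBounded ε hε
  have : Fintype t := htfin.fintype
  obtain ⟨x₁, hx₁⟩ := hne
  have : Nonempty t := by
    obtain ⟨y, hy, -⟩ := Set.mem_iUnion₂.1 (hcover (hmaps hx₁))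
    exact ⟨⟨y, hy⟩⟩
  let φ : t → E → ℝ := fun y z => max 0 (ε - dist z y)
  have hφ0 : ∀ y z, 0 ≤ φ y z := fun y z => le_max_left _ _
  have hφc : ∀ y, Continuous (φ y) := fun y => by fun_prop
  have hsum : ∀ z ∈ K, 0 < ∑ y, φ y z := by
    intro z hz
    obtain ⟨y, hy, hball⟩ := Set.mem_iUnion₂.1 (hcover hz)
    refine Finset.sum_pos' (fun y _ => hφ0 y z) ⟨⟨y, hy⟩, Finset.mem_univ _, ?_⟩
    exact lt_max_of_lt_right (sub_pos.2 (Metric.mem_ball.1 hball))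
  let b : (t → ℝ) → E := fun w => ∑ y, w y • (y : E)
  have hbc : Continuous b := by fun_prop
  have hbC : Set.MapsTo b (stdSimplex ℝ t) C := fun w hw =>
    hC.sum_mem (fun y _ => hw.1 y) hw.2 fun y _ => hKC (htK y.2)
  -- `P` is the Schauder projection, written in barycentric coordinates.
  let P : E → t → ℝ := fun z y => φ y z / ∑ y', φ y' z
  have hPc : ContinuousOn P K := by
    refine continuousOn_pi.2 fun y => ?_
    exact (hφc y).continuousOn.div (by fun_prop) fun z hz => (hsum z hz).ne'
  have hPmem : ∀ z ∈ K, P z ∈ stdSimplex ℝ t := fun z hz =>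
    ⟨fun y => div_nonneg (hφ0 y z) (hsum z hz).le, by
      simp only [P]
      rw [← Finset.sum_div, div_self (hsum z hz).ne']⟩
  have hPz : ∀ z ∈ K, dist (b (P z)) z ≤ ε := by
    intro z hz
    have hmem := hPmem z hz
    have h1 : b (P z) - z = ∑ y, P z y • ((y : E) - z) := by
      simp only [smul_sub, Finset.sum_sub_distrib, ← Finset.sum_smul, hmem.2, one_smul, b]
    rw [dist_eq_norm, h1]
    calc ‖∑ y, P z y • ((y : E) - z)‖ ≤ ∑ y, P z y * ε := by
          refine norm_sum_le_of_le _ fun y _ => ?_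
          rw [norm_smul, Real.norm_of_nonneg (hmem.1 y)]
          by_cases hd : dist z y ≤ ε
          · refine mul_le_mul_of_nonneg_left ?_ (hmem.1 y)
            rwa [← dist_eq_norm, dist_comm]
          · have : P z y = 0 := by
              have : φ y z = 0 := max_eq_left (by linarith)
              simp only [P]
              rw [this, zero_div]
            simp [this]
      _ = ε := by rw [← Finset.sum_mul, hmem.2, one_mul]
  obtain ⟨w, hw, hfix⟩ := exists_fixedPoint_of_mapsTo_stdSimplex (f := fun w => P (T (b w)))
    (hPc.comp (hT.comp hbc.continuousOn hbC) fun w hw => hmaps (hbC hw))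
    fun w hw => hPmem _ (hmaps (hbC hw))
  refine ⟨b w, hbC hw, ?_⟩
  have := hPz (T (b w)) (hmaps (hbC hw))
  rwa [show P (T (b w)) = w from hfix] at this

/-- **Schauder's fixed point theorem** for a self-map of a closed convex set with relatively
compact range. -/
theorem exists_fixedPoint_of_mapsTo_convex {E : Type*} [NormedAddCommGroup E] [NormedSpace ℝ E]
    {C K : Set E} (hC : Convex ℝ C) (hCc : IsClosed C) (hne : C.Nonempty) (hK : IsCompact K)
    {T : E → E} (hT : ContinuousOn T C) (hTC : Set.MapsTo T C C) (hTK : Set.MapsTo T C K) :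
    ∃ x ∈ C, T x = x := by
  have hK' : IsCompact (K ∩ C) := hK.inter_right hCc
  have hmaps : Set.MapsTo T C (K ∩ C) := fun x hx => ⟨hTK hx, hTC hx⟩
  choose x hxC hx using fun n : ℕ => exists_dist_le_of_mapsTo_convex hC hne hK'
    Set.inter_subset_right hT hmaps (ε := 1 / ((n : ℝ) + 1)) Nat.one_div_pos_of_nat
  obtain ⟨y, hy, φ, hφ, hlim⟩ := hK'.tendsto_subseq fun n => hmaps (hxC n)
  have hd : Filter.Tendsto (fun n => dist (x (φ n)) (T (x (φ n)))) Filter.atTop (nhds 0) :=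
    squeeze_zero (fun _ => dist_nonneg) (fun n => hx (φ n))
      (tendsto_one_div_add_atTop_nhds_zero_nat.comp hφ.tendsto_atTop)
  have hxy : Filter.Tendsto (fun n => x (φ n)) Filter.atTop (nhds y) :=
    (tendsto_iff_of_dist hd).2 hlim
  refine ⟨y, hy.2, tendsto_nhds_unique ?_ hlim⟩
  exact (hT y hy.2).tendsto.comp
    (tendsto_nhdsWithin_iff.2 ⟨hxy, Filter.Eventually.of_forall fun n => hxC (φ n)⟩)

/-! ### The functional `sinIntegral` and the set `VSet M` -/

noncomputable section

open MeasureTheory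

instance isFiniteMeasure_comap_Icc (a b : ℝ) : IsFiniteMeasure
    (Measure.comap (Subtype.val : Set.Icc a b → ℝ) volume) :=
  ⟨by
    rw [comap_subtype_coe_apply measurableSet_Icc, Set.image_univ, Subtype.range_coe]
    exact measure_Icc_lt_top⟩

theorem integrable_mul_sin (v : CZeroPi) :
    Integrable (fun x : Set.Icc (0 : ℝ) Real.pi => v x * Real.sin (x : ℝ))
      (Measure.comap Subtype.val volume) :=
  Continuous.integrable_of_hasCompactSupport (by fun_prop)
    (HasCompactSupport.of_compactSpace _)

/-- `sinIntegral` as a continuous linear functional. -/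
def sinIntegralCLM : CZeroPi →L[ℝ] ℝ :=
  LinearMap.mkContinuous
    { toFun := sinIntegral
      map_add' := fun v w => by
        simp only [sinIntegral, ContinuousMap.add_apply, add_mul]
        exact integral_add (integrable_mul_sin v) (integrable_mul_sin w)
      map_smul' := fun a v => by
        simp only [sinIntegral, ContinuousMap.smul_apply, smul_eq_mul, mul_assoc,
          RingHom.id_apply]
        exact integral_const_mul _ _ }
    ((Measure.comap (Subtype.val : Set.Icc (0 : ℝ) Real.pi → ℝ) volume).real Set.univ)
    fun v => by
      rw [mul_comm]
      refine norm_integral_le_of_norm_le_const (Filter.Eventually.of_forall fun x => ?_)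
      rw [norm_mul]
      exact (mul_le_of_le_one_right (norm_nonneg _) (Real.abs_sin_le_one _)).trans
        (v.norm_coe_le_norm x)

theorem sinIntegralCLM_apply (v : CZeroPi) : sinIntegralCLM v = sinIntegral v := rfl

theorem sinIntegral_mono {v w : CZeroPi} (h : ∀ x, v x ≤ w x) :
    sinIntegral v ≤ sinIntegral w :=
  integral_mono (integrable_mul_sin v) (integrable_mul_sin w) fun x =>
    mul_le_mul_of_nonneg_right (h x) (Real.sin_nonneg_of_mem_Icc x.2)

theorem convex_VSet (M : ℝ) : Convex ℝ (VSet M) := by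
  rintro v ⟨hv, hv1⟩ w ⟨hw, hw1⟩ a b ha hb hab
  refine ⟨fun x => ?_, ?_⟩
  · exact convex_Icc 0 M (hv x) (hw x) ha hb hab
  · rw [← sinIntegralCLM_apply, map_add, map_smul, map_smul, sinIntegralCLM_apply,
      sinIntegralCLM_apply, hv1, hw1, smul_eq_mul, smul_eq_mul, mul_one, mul_one, hab]

theorem isClosed_VSet (M : ℝ) : IsClosed (VSet M) := by
  have h1 : IsClosed {v : CZeroPi | ∀ x, v x ∈ Set.Icc 0 M} := by
    simp only [Set.ofPred_forall]
    exact isClosed_iInter fun x => isClosed_Icc.preimage (continuous_eval_const x)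
  exact h1.inter (isClosed_eq sinIntegralCLM.continuous continuous_const)

theorem continuous_powFun (p : ℝ) (hp : 0 ≤ p) : Continuous (powFun p hp) :=
  ContinuousMap.continuous_postcomp
    ⟨fun t : ℝ => t ^ p, continuous_id.rpow_const fun _ => Or.inr hp⟩

theorem powFun_smul (p : ℝ) (hp : 0 ≤ p) {a : ℝ} (ha : 0 ≤ a) {v : CZeroPi}
    (hv : ∀ x, 0 ≤ v x) : powFun p hp (a • v) = a ^ p • powFun p hp v :=
  ContinuousMap.ext fun x => Real.mul_rpow ha (hv x)

theorem norm_powFun_le (p : ℝ) (hp : 0 ≤ p) {M : ℝ} (hM : 0 ≤ M) {v : CZeroPi}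
    (hv : ∀ x, 0 ≤ v x ∧ v x ≤ M) : ‖powFun p hp v‖ ≤ M ^ p := by
  refine (ContinuousMap.norm_le _ (Real.rpow_nonneg hM p)).2 fun x => ?_
  change ‖v x ^ p‖ ≤ M ^ p
  rw [Real.norm_of_nonneg (Real.rpow_nonneg (hv x).1 p)]
  exact Real.rpow_le_rpow (hv x).1 (hv x).2 hp

/-- The constraint `∫ v sin = 1` keeps `∫ v ^ p sin` away from `0` on `VSet M`; this makes the
normalization by `∫ A v sin` continuous with bounded factor. -/
theorem exists_pos_le_sinIntegral_powFun (p : ℝ) (hp : 0 ≤ p) {M : ℝ} (hM : 0 < M) :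
    ∃ δ > 0, ∀ v ∈ VSet M, δ ≤ sinIntegral (powFun p hp v) := by
  set s : ℝ := sinIntegral (1 : CZeroPi) with hs
  have hs0 : 0 ≤ s := by
    have := sinIntegral_mono (v := 0) (w := 1) fun x => zero_le_one
    rwa [← sinIntegralCLM_apply, map_zero] at this
  set a : ℝ := 1 / (2 * (s + 1)) with ha
  have ha0 : 0 < a := by positivity
  have has : a * s ≤ 1 / 2 := by
    rw [ha, div_mul_eq_mul_div, div_le_div_iff₀ (by positivity) two_pos]
    linarith
  set B : ℝ := M / a ^ p with hB
  have hap : 0 < a ^ p := Real.rpow_pos_of_pos ha0 p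
  have hB0 : 0 < B := div_pos hM hap
  refine ⟨1 / (2 * B), by positivity, fun v hv => ?_⟩
  -- `t ≤ a + B t ^ p` on `[0, M]`: either `t ≤ a`, or `B t ^ p ≥ B a ^ p = M`.
  have hle : ∀ x, v x ≤ (a • (1 : CZeroPi) + B • powFun p hp v) x := by
    intro x
    have hpow : (0 : ℝ) ≤ v x ^ p := Real.rpow_nonneg (hv.1 x).1 p
    change v x ≤ a * 1 + B * v x ^ p
    rcases le_total (v x) a with h | h
    · have := mul_nonneg hB0.le hpow
      linarith
    · have h1 : B * a ^ p ≤ B * v x ^ p :=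
        mul_le_mul_of_nonneg_left (Real.rpow_le_rpow ha0.le h hp) hB0.le
      have h2 : B * a ^ p = M := div_mul_cancel₀ M hap.ne'
      linarith [(hv.1 x).2]
  have hint := sinIntegral_mono hle
  rw [hv.2, ← sinIntegralCLM_apply, map_add, map_smul, map_smul, sinIntegralCLM_apply,
    sinIntegralCLM_apply, ← hs, smul_eq_mul, smul_eq_mul] at hint
  rw [div_le_iff₀ (by positivity)]
  linarith

end

/-! ### The fixed point of the homogeneous operator -/

theorem proposition2p3 (M : ℝ) (hM : 0 < M) (hV : (VSet M).Nonempty)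
    (α : ℝ) (hα : 0 < α) (hα1 : α ≠ 1)
    (S : CZeroPi →ₗ[ℝ] CZeroPi) (hS : IsCompactOperator S)
    (h1 : ∃ ρ : ℝ, 0 < ρ ∧ ∀ v ∈ VSet M,
      sinIntegral (opA α hα S v) =
        ρ * sinIntegral (powFun (1 / α) (one_div_pos.mpr hα).le v))
    (h2 : ∀ v ∈ VSet M, ∀ x : Set.Icc (0 : ℝ) Real.pi,
      0 ≤ opA α hα S v x ∧ opA α hα S v x ≤ M * sinIntegral (opA α hα S v)) :
    ∃ w : CZeroPi, w ≠ 0 ∧ opA α hα S w = w ∧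
      ∃ Γ : ℝ, 0 < Γ ∧ ∃ v ∈ VSet M, w = Γ • v := by
  obtain ⟨ρ, hρ, h1⟩ := h1
  set p : ℝ := 1 / α with hp
  have hp0 : 0 ≤ p := (one_div_pos.mpr hα).le
  obtain ⟨δ, hδ, hδV⟩ := exists_pos_le_sinIntegral_powFun p hp0 hM
  set c : CZeroPi → ℝ := fun v => sinIntegral (opA α hα S v) with hc
  have hcδ : ∀ v ∈ VSet M, ρ * δ ≤ c v := fun v hv => by
    change ρ * δ ≤ sinIntegral (opA α hα S v)
    rw [h1 v hv]
    exact mul_le_mul_of_nonneg_left (hδV v hv) hρ.le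
  have hρδ : 0 < ρ * δ := mul_pos hρ hδ
  have hc0 : ∀ v ∈ VSet M, 0 < c v := fun v hv => hρδ.trans_le (hcδ v hv)
  have hAcont : Continuous (opA α hα S) :=
    (IsCompactOperator.continuous hS).comp (continuous_powFun p hp0)
  have hccont : Continuous c := sinIntegralCLM.continuous.comp hAcont
  obtain ⟨K, hK, hSK⟩ := IsCompactOperator.image_subset_compact_of_bounded hS
    (Metric.isBounded_closedBall (x := (0 : CZeroPi)) (r := M ^ p))
  have hAK : ∀ v ∈ VSet M, opA α hα S v ∈ K := fun v hv =>
    hSK ⟨_, mem_closedBall_zero_iff.2 (norm_powFun_le p hp0 hM.le hv.1), rfl⟩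
  have hTV : Set.MapsTo (fun v => (c v)⁻¹ • opA α hα S v) (VSet M) (VSet M) := by
    intro v hv
    have hcv := hc0 v hv
    refine ⟨fun x => ⟨mul_nonneg (inv_pos.2 hcv).le (h2 v hv x).1, ?_⟩, ?_⟩
    · change (c v)⁻¹ * opA α hα S v x ≤ M
      rw [inv_mul_le_iff₀ hcv, mul_comm]
      exact (h2 v hv x).2
    · change sinIntegral ((c v)⁻¹ • opA α hα S v) = 1
      rw [← sinIntegralCLM_apply, map_smul, sinIntegralCLM_apply]
      exact inv_mul_cancel₀ hcv.ne'
  obtain ⟨v, hv, hfix⟩ := exists_fixedPoint_of_mapsTo_convex (convex_VSet M) (isClosed_VSet M) hV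
    ((isCompact_Icc (a := (0 : ℝ)) (b := (ρ * δ)⁻¹)).smul_set hK)
    ((hccont.continuousOn.inv₀ fun v hv => (hc0 v hv).ne').smul hAcont.continuousOn) hTV
    fun v hv => Set.smul_mem_smul
      ⟨(inv_pos.2 (hc0 v hv)).le, inv_anti₀ hρδ (hcδ v hv)⟩ (hAK v hv)
  have hcv := hc0 v hv
  have hAv : opA α hα S v = c v • v := (inv_smul_eq_iff₀ hcv.ne').1 hfix
  have hp1 : 1 - p ≠ 0 := by
    rw [hp, sub_ne_zero, ne_comm, Ne, div_eq_one_iff_eq hα.ne']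
    exact fun h => hα1 h.symm
  -- `A (Γ v) = Γ ^ p • A v`, so `Γ` has to solve `Γ ^ p * c v = Γ`.
  set Γ : ℝ := c v ^ (1 / (1 - p)) with hΓ
  have hΓ0 : 0 < Γ := Real.rpow_pos_of_pos hcv _
  have hΓeq : Γ ^ p * c v = Γ := by
    rw [hΓ, ← Real.rpow_mul hcv.le]
    nth_rewrite 2 [← Real.rpow_one (c v)]
    rw [← Real.rpow_add hcv]
    congr 1
    field_simp
    ring
  refine ⟨Γ • v, smul_ne_zero hΓ0.ne' ?_, ?_, Γ, hΓ0, v, hv, rfl⟩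
  · rintro rfl
    have := hv.2
    rw [← sinIntegralCLM_apply, map_zero] at this
    exact zero_ne_one this
  · change S (powFun p hp0 (Γ • v)) = Γ • v
    rw [powFun_smul p hp0 hΓ0.le fun x => (hv.1 x).1, map_smul]
    change Γ ^ p • opA α hα S v = Γ • v
    rw [hAv, smul_smul, hΓeq]
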